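/- Let $\mathbf{F}$ be a field and let $X_1, X_2$ be topological spaces of finite type over $\mathbf{F}$, that is, $H^k(X_i;\mathbf{F})$ is finite-dimensional for every $k$. (All cohomology is singular cohomology with coefficients in $\mathbf{F}$.) For classes $\alpha\in H^p(X)$, $\beta\in H^q(X)$, $\gamma\in H^r(X)$ of a space $X$, the Massey product $\langle\alpha,\beta,\gamma\rangle$ is said to be defined if $\alpha\beta=0=\beta\gamma$, and it is then the set of all classes in $H^{p+q+r-1}(X)$ of the form $[a\bullet\lambda+(-1)^{p+1}\mu\bullet c]$, where $a,b,c$ are singular cocycles representing $\alpha,\beta,\gamma$, where $\mu\in C^{p+q-1}(X)$ and $\lambda\in C^{q+r-1}(X)$ are cochains with $d\mu=a\bullet b$ and $d\lambda=b\bullet c$, and where $\bullet$ is the usual multiplication of singular cochains. Let $\alpha_i,\beta_i,\gamma_i$ be homogeneous classes in $H^*(X_i;\mathbf{F})$, $i=1,2$, and suppose that the Massey product $$\theta=\langle\alpha_1\times\alpha_2,\ \beta_1\times\beta_2,\ \gamma_1\times\gamma_2\rangle\subseteq H^*(X_1\times X_2;\mathbf{F})$$ is defined, where $\times$ denotes the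 cohomology cross product. If either $\alpha_1\beta_1=0$ and $\beta_2\gamma_2=0$, or $\alpha_2\beta_2=0$ and $\beta_1\gamma_1=0$, then $\theta$ contains the zero class. -/

import Mathlib

set_option linter.unusedSectionVars false

noncomputable section

open scoped BigOperators

/-- A singular `n`-simplex of `X`: a continuous map from the standard `n`-simplex, whose vertices
are indexed by `Fin (n + 1)`. -/
abbrev SingularSimplex (X : Type*) [TopologicalSpace X] (n : ℕ) : Type _ :=
  C(stdSimplex ℝ (Fin (n + 1)), X)

/-- Precomposition of a singular simplex with the affine map of standard simplices given by a map
`φ` of vertices; in the usual notation it is `σ ∘ [v_{φ 0}, …, v_{φ m}]`. -/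
def SingularSimplex.restrict {X : Type*} [TopologicalSpace X] {m n : ℕ} (σ : SingularSimplex X n)
    (φ : Fin (m + 1) → Fin (n + 1)) : SingularSimplex X m :=
  ContinuousMap.comp σ ⟨stdSimplex.map φ, stdSimplex.continuous_map φ⟩

/-- Singular cochains of `X` with coefficients in `R`: functions on the set of singular simplices
of all dimensions. The cochains of degree `k` are singled out in `SingularCochain.degree`. -/
abbrev SingularCochain (R X : Type*) [TopologicalSpace X] : Type _ :=
  (Σ n : ℕ, SingularSimplex X n) → R

namespace SingularCochain

variable (R : Type*) [CommRing R] {X Y : Type*} [TopologicalSpace X] [TopologicalSpace Y]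

/-- The module `C^k(X; R)` of singular cochains of degree `k`: those that vanish on all simplices
whose dimension is not `k`. It is zero for `k < 0`. -/
def degree (X : Type*) [TopologicalSpace X] (k : ℤ) : Submodule R (SingularCochain R X) where
  carrier := {f | ∀ (n : ℕ) (σ : SingularSimplex X n), (n : ℤ) ≠ k → f ⟨n, σ⟩ = 0}
  zero_mem' := fun _ _ _ => rfl
  add_mem' := fun {f g} hf hg n σ h => by simp [hf n σ h, hg n σ h]
  smul_mem' := fun c f hf n σ h => by simp [hf n σ h]

variable {R}

/-- The singular coboundary, `(d f)(σ) = f(∂ σ) = ∑ i, (-1) ^ i f(σ ∘ [v₀, …, v̂ᵢ, …])`. -/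
def d : SingularCochain R X →ₗ[R] SingularCochain R X where
  toFun f := fun s => match s with
    | ⟨0, _⟩ => 0
    | ⟨n + 1, σ⟩ => ∑ i : Fin (n + 2), (-1) ^ (i : ℕ) * f ⟨n, σ.restrict i.succAbove⟩
  map_add' f g := by
    funext s
    match s with
    | ⟨0, _⟩ => simp
    | ⟨n + 1, σ⟩ => simp [mul_add, Finset.sum_add_distrib]
  map_smul' c f := by
    funext s
    match s with
    | ⟨0, _⟩ => simp
    | ⟨n + 1, σ⟩ => simp [Finset.mul_sum, mul_left_comm]

/-- The cochain multiplication: on an `n`-simplex `σ`,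
`(f • g)(σ) = ∑ i, f(σ ∘ [v₀, …, vᵢ]) g(σ ∘ [vᵢ, …, vₙ])`. If `f` has degree `p` and `g` has
degree `q`, only the term `i = p`, `n = p + q` can be nonzero. -/
def mul (f g : SingularCochain R X) : SingularCochain R X := fun s =>
  ∑ i : Fin (s.1 + 1),
    f ⟨i, s.2.restrict (fun j => ⟨j, by omega⟩)⟩ *
      g ⟨s.1 - i, s.2.restrict (fun j => ⟨i + j, by omega⟩)⟩

/-- The cochain map induced by a continuous map. -/
def pullback (φ : C(X, Y)) : SingularCochain R Y →ₗ[R] SingularCochain R X where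
  toFun f := fun s => f ⟨s.1, φ.comp s.2⟩
  map_add' _ _ := rfl
  map_smul' _ _ := rfl

/-- Evaluation of a cochain on `σ ∘ [v_{v 0}, …, v_{v m}]`. -/
def ev (f : SingularCochain R X) {n : ℕ} (σ : SingularSimplex X n) (m : ℕ) (v : ℕ → ℕ) : R :=
  f ⟨m, σ.restrict (fun j => Fin.ofNat (n + 1) (v j))⟩

lemma ev_congr (f : SingularCochain R X) {n : ℕ} (σ : SingularSimplex X n) (m : ℕ) {v w : ℕ → ℕ}
    (h : ∀ j ≤ m, v j = w j) : f.ev σ m v = f.ev σ m w := by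
  have : (fun j : Fin (m + 1) => Fin.ofNat (n + 1) (v j)) = fun j : Fin (m + 1) => Fin.ofNat (n + 1) (w j) := by
    funext j
    rw [h j (by omega)]
  unfold ev
  rw [this]

lemma restrict_restrict {l m n : ℕ} (σ : SingularSimplex X n)
    (φ : Fin (m + 1) → Fin (n + 1)) (ψ : Fin (l + 1) → Fin (m + 1)) :
    (σ.restrict φ).restrict ψ = σ.restrict (φ ∘ ψ) := by
  ext x
  simp [SingularSimplex.restrict, stdSimplex.map_comp_apply]

lemma restrict_id {n : ℕ} (σ : SingularSimplex X n) : σ.restrict id = σ := by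
  ext x
  simp [SingularSimplex.restrict]

/-- The increasing map of natural numbers that omits the value `k`. -/
def skip (k j : ℕ) : ℕ := if j < k then j else j + 1

lemma ev_restrict (f : SingularCochain R X) {n m : ℕ} (σ : SingularSimplex X n) (l : ℕ)
    (u v : ℕ → ℕ) (hv : ∀ j ≤ l, v j ≤ m) :
    f.ev (σ.restrict (fun j : Fin (m + 1) => Fin.ofNat (n + 1) (u j))) l v =
      f.ev σ l (fun j => u (v j)) := by
  unfold ev
  rw [restrict_restrict]
  congr 3
  funext j
  have := hv j (by omega)
  simp [Nat.mod_eq_of_lt (Nat.lt_succ_of_le this)]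

lemma d_ev (f : SingularCochain R X) {n : ℕ} (σ : SingularSimplex X n) (m : ℕ) (u : ℕ → ℕ) :
    (d f).ev σ (m + 1) u =
      ∑ k ∈ Finset.range (m + 2), (-1) ^ k * f.ev σ m (fun j => u (skip k j)) := by
  have h : ∀ k : Fin (m + 2), f ⟨m, (σ.restrict (fun j : Fin (m + 2) =>
      Fin.ofNat (n + 1) (u j))).restrict k.succAbove⟩ =
      f.ev σ m (fun j => u (skip k j)) := by
    intro k
    unfold ev
    rw [restrict_restrict]
    congr 3
    funext j
    simp only [Function.comp, skip, Fin.succAbove, Fin.lt_def, Fin.val_castSucc]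
    split_ifs <;> rfl
  rw [Finset.sum_range]
  simp only [← h]
  rfl

lemma d_apply_succ (f : SingularCochain R X) {n : ℕ} (σ : SingularSimplex X (n + 1)) :
    d f ⟨n + 1, σ⟩ = ∑ k ∈ Finset.range (n + 2), (-1) ^ k * f.ev σ n (skip k) := by
  have := d_ev f σ n id
  have h : (d f).ev σ (n + 1) id = d f ⟨n + 1, σ⟩ := by
    unfold ev
    have : (fun j : Fin (n + 1 + 1) => Fin.ofNat (n + 1 + 1) (id (j : ℕ))) = id := by
      funext j
      simp
    rw [this, restrict_id]
  rw [← h, this]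
  rfl

lemma mul_ev (f g : SingularCochain R X) {n : ℕ} (σ : SingularSimplex X n) (m : ℕ) (u : ℕ → ℕ) :
    (f.mul g).ev σ m u =
      ∑ i ∈ Finset.range (m + 1), f.ev σ i u * g.ev σ (m - i) (fun j => u (i + j)) := by
  rw [Finset.sum_range]
  unfold ev mul
  simp only [restrict_restrict]
  rfl

lemma mul_apply (f g : SingularCochain R X) {n : ℕ} (σ : SingularSimplex X n) :
    f.mul g ⟨n, σ⟩ =
      ∑ i ∈ Finset.range (n + 1), f.ev σ i id * g.ev σ (n - i) (fun j => i + j) := by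
  have := mul_ev f g σ n id
  have h : (f.mul g).ev σ n id = f.mul g ⟨n, σ⟩ := by
    unfold ev
    have : (fun j : Fin (n + 1) => Fin.ofNat (n + 1) (id (j : ℕ))) = id := by
      funext j
      simp
    rw [this, restrict_id]
  rw [← h, this]
  rfl

lemma ev_eq_zero {p : ℤ} {f : SingularCochain R X} (hf : f ∈ degree R X p) {n : ℕ}
    (σ : SingularSimplex X n) (m : ℕ) (v : ℕ → ℕ) (h : (m : ℤ) ≠ p) : f.ev σ m v = 0 :=
  hf m _ h

lemma neg_one_ev {p : ℤ} {f : SingularCochain R X} (hf : f ∈ degree R X p) {n : ℕ}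
    (σ : SingularSimplex X n) (m : ℕ) (v : ℕ → ℕ) :
    p.negOnePow • f.ev σ m v = (-1) ^ m * f.ev σ m v := by
  by_cases h : (m : ℤ) = p
  · subst h
    rw [Int.negOnePow_def, Units.smul_def]
    simp
  · simp [ev_eq_zero hf σ m v h]

/-- The Leibniz rule `d(f • g) = df • g + (-1)^p f • dg` for `f` of degree `p`. -/
theorem d_mul {p : ℤ} {f : SingularCochain R X} (hf : f ∈ degree R X p) (g : SingularCochain R X) :
    d (f.mul g) = (d f).mul g + p.negOnePow • f.mul (d g) := by
  funext ⟨n, σ⟩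
  cases n with
  | zero =>
    have h0 : ∀ (g : SingularCochain R X) (v), (d g).ev σ 0 v = 0 := fun _ _ => rfl
    have : (d (f.mul g)) ⟨0, σ⟩ = 0 := rfl
    rw [this, Pi.add_apply, Pi.smul_apply, mul_apply, mul_apply]
    simp [h0]
  | succ n =>
    have hA : (d f).mul g ⟨n + 1, σ⟩ = ∑ i ∈ Finset.range (n + 1),
        ∑ k ∈ Finset.range (i + 2), (-1) ^ k *
          (f.ev σ i (skip k) * g.ev σ (n - i) (fun j => i + 1 + j)) := by
      have h0 : (d f).ev σ 0 id = 0 := rfl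
      rw [mul_apply, Finset.sum_range_succ', h0, zero_mul, add_zero]
      refine Finset.sum_congr rfl fun i _ => ?_
      rw [d_ev, Finset.sum_mul, Nat.add_sub_add_right]
      refine Finset.sum_congr rfl fun k _ => ?_
      rw [mul_assoc]
      rfl
    have hB : (p.negOnePow • f.mul (d g)) ⟨n + 1, σ⟩ = ∑ i ∈ Finset.range (n + 1),
        ∑ k ∈ Finset.range (n - i + 2), (-1) ^ (i + k) *
          (f.ev σ i id * g.ev σ (n - i) (fun j => i + skip k j)) := by
      have h0 : ∀ v, (d g).ev σ 0 v = 0 := fun _ => rfl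
      rw [Pi.smul_apply, mul_apply, Finset.sum_range_succ, Nat.sub_self, h0, mul_zero, add_zero,
        Finset.smul_sum]
      refine Finset.sum_congr rfl fun i hi => ?_
      have hi' : i ≤ n := Nat.lt_succ_iff.mp (Finset.mem_range.mp hi)
      rw [Nat.succ_sub hi', Nat.succ_eq_add_one, d_ev, ← smul_mul_assoc, neg_one_ev hf,
        Finset.mul_sum]
      refine Finset.sum_congr rfl fun k _ => ?_
      rw [pow_add]
      ring
    have hC : d (f.mul g) ⟨n + 1, σ⟩ = ∑ i ∈ Finset.range (n + 1),
        ∑ k ∈ Finset.range (n + 2), (-1) ^ k *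
          (f.ev σ i (skip k) * g.ev σ (n - i) (fun j => skip k (i + j))) := by
      rw [d_apply_succ, Finset.sum_comm]
      refine Finset.sum_congr rfl fun k _ => ?_
      rw [mul_ev, Finset.mul_sum]
    rw [Pi.add_apply, hA, hB, hC, ← Finset.sum_add_distrib]
    refine Finset.sum_congr rfl fun i hi => ?_
    have hi' : i ≤ n := Nat.lt_succ_iff.mp (Finset.mem_range.mp hi)
    have hsplit : n + 2 = (i + 1) + (n - i + 1) := by omega
    rw [hsplit, Finset.sum_range_add, Finset.sum_range_succ _ (i + 1),
      Finset.sum_range_succ' _ (n - i + 1)]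
    have h1 : ∑ k ∈ Finset.range (i + 1), (-1) ^ k *
          (f.ev σ i (skip k) * g.ev σ (n - i) (fun j => skip k (i + j))) =
        ∑ k ∈ Finset.range (i + 1), (-1) ^ k *
          (f.ev σ i (skip k) * g.ev σ (n - i) (fun j => i + 1 + j)) := by
      refine Finset.sum_congr rfl fun k hk => ?_
      have hk' := Finset.mem_range.mp hk
      rw [ev_congr g σ (n - i) (w := fun j => i + 1 + j)]
      intro j _
      simp only [skip]
      split_ifs <;> omega
    have h2 : ∑ k ∈ Finset.range (n - i + 1), (-1) ^ (i + 1 + k) *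
          (f.ev σ i (skip (i + 1 + k)) * g.ev σ (n - i) (fun j => skip (i + 1 + k) (i + j))) =
        ∑ k ∈ Finset.range (n - i + 1), (-1) ^ (i + (k + 1)) *
          (f.ev σ i id * g.ev σ (n - i) (fun j => i + skip (k + 1) j)) := by
      refine Finset.sum_congr rfl fun k _ => ?_
      rw [ev_congr f σ i (w := id), ev_congr g σ (n - i) (w := fun j => i + skip (k + 1) j)]
      · congr 2
        omega
      · intro j _
        simp only [skip]
        split_ifs <;> omega
      · intro j _
        simp only [skip, id]
        split_ifs <;> omega
    have h3 : f.ev σ i (skip (i + 1)) = f.ev σ i id := ev_congr f σ i fun j _ => by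
      simp only [skip, id]
      split_ifs <;> omega
    have h4 : g.ev σ (n - i) (fun j => i + skip 0 j) = g.ev σ (n - i) (fun j => i + 1 + j) :=
      ev_congr g σ (n - i) fun j _ => by
        simp only [skip]
        split_ifs <;> omega
    rw [h1, h2, h3, h4, pow_add, add_zero]
    ring

lemma mul_mem {p q k : ℤ} {f g : SingularCochain R X} (hf : f ∈ degree R X p)
    (hg : g ∈ degree R X q) (hk : p + q = k) : f.mul g ∈ degree R X k := by
  intro n σ h
  refine Finset.sum_eq_zero fun i _ => ?_
  by_cases hi : ((i : ℕ) : ℤ) = p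
  · have := i.isLt
    have hn : ((n - (i : ℕ) : ℕ) : ℤ) ≠ q := by
      change (i : ℕ) < n + 1 at this
      omega
    rw [hg (n - i) _ hn, mul_zero]
  · rw [hf i _ hi, zero_mul]

lemma d_mem {k l : ℤ} {f : SingularCochain R X} (hf : f ∈ degree R X k) (hl : k + 1 = l) :
    d f ∈ degree R X l := by
  intro n σ h
  cases n with
  | zero => rfl
  | succ n =>
    have hn : (n : ℤ) ≠ k := by omega
    rw [d_apply_succ]
    exact Finset.sum_eq_zero fun i _ => by rw [ev_eq_zero hf σ n _ hn, mul_zero]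

lemma pullback_mem (φ : C(X, Y)) {k : ℤ} {f : SingularCochain R Y} (hf : f ∈ degree R Y k) :
    pullback φ f ∈ degree R X k := fun n σ h => hf n (φ.comp σ) h

lemma d_pullback (φ : C(X, Y)) (f : SingularCochain R Y) :
    d (pullback φ f) = pullback φ (d f) := by
  funext ⟨n, σ⟩
  cases n <;> rfl

/-- The cochain multiplication as a bilinear map. -/
def mulₗ : SingularCochain R X →ₗ[R] SingularCochain R X →ₗ[R] SingularCochain R X :=
  LinearMap.mk₂ R mul
    (fun f f' g => by funext s; simp [mul, add_mul, Finset.sum_add_distrib])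
    (fun c f g => by funext s; simp [mul, Finset.mul_sum, mul_assoc])
    (fun f g g' => by funext s; simp [mul, mul_add, Finset.sum_add_distrib])
    (fun c f g => by funext s; simp [mul, Finset.mul_sum, mul_left_comm])

variable (R)

/-- The cocycles of degree `k`. -/
def cocycles (X : Type*) [TopologicalSpace X] (k : ℤ) : Submodule R (SingularCochain R X) :=
  degree R X k ⊓ LinearMap.ker d

/-- The coboundaries of degree `k`: the image under `d` of the cochains of degree `k - 1`. -/
def coboundaries (X : Type*) [TopologicalSpace X] (k : ℤ) : Submodule R (SingularCochain R X) :=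
  (degree R X (k - 1)).map d

variable {R}

lemma mul_mem_cocycles {p q : ℤ} {f g : SingularCochain R X} (hf : f ∈ cocycles R X p)
    (hg : g ∈ cocycles R X q) : f.mul g ∈ cocycles R X (p + q) := by
  refine ⟨mul_mem hf.1 hg.1 rfl, ?_⟩
  have h1 : d f = 0 := hf.2
  have h2 : d g = 0 := hg.2
  have hz : ∀ h : SingularCochain R X, mul 0 h = 0 := fun h => LinearMap.map_zero₂ mulₗ h
  have hz' : ∀ h : SingularCochain R X, mul h 0 = 0 := fun h => (mulₗ h).map_zero
  change d (f.mul g) = 0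
  rw [d_mul hf.1, h1, h2, hz, hz', smul_zero, add_zero]

lemma mul_mem_coboundaries_left {p q : ℤ} {f g : SingularCochain R X}
    (hf : f ∈ coboundaries R X p) (hg : g ∈ cocycles R X q) :
    f.mul g ∈ coboundaries R X (p + q) := by
  obtain ⟨h, hh, rfl⟩ := hf
  have h2 : d g = 0 := hg.2
  have hz' : mul h 0 = 0 := (mulₗ h).map_zero
  exact ⟨h.mul g, mul_mem hh hg.1 (by ring), by rw [d_mul hh, h2, hz', smul_zero, add_zero]⟩

lemma mul_mem_coboundaries_right {p q : ℤ} {f g : SingularCochain R X}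
    (hf : f ∈ cocycles R X p) (hg : g ∈ coboundaries R X q) :
    f.mul g ∈ coboundaries R X (p + q) := by
  obtain ⟨h, hh, rfl⟩ := hg
  have h2 : d f = 0 := hf.2
  have hz : ∀ h : SingularCochain R X, mul 0 h = 0 := fun h => LinearMap.map_zero₂ mulₗ h
  refine ⟨p.negOnePow • f.mul h, ?_, ?_⟩
  · have := mul_mem hf.1 hh (k := p + q - 1) (by ring)
    rw [Units.smul_def]
    exact (degree R X (p + q - 1)).toAddSubgroup.zsmul_mem this _
  · rw [Units.smul_def, map_zsmul, ← Units.smul_def, d_mul hf.1, h2, hz, zero_add, smul_smul,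
      ← Int.negOnePow_add, Int.negOnePow_even _ ⟨p, rfl⟩, one_smul]

end SingularCochain

open SingularCochain

/-- The singular cohomology module `H^k(X; R)`: cocycles of degree `k` modulo coboundaries. -/
abbrev SingularCohomology (R : Type*) [CommRing R] (X : Type*) [TopologicalSpace X] (k : ℤ) :
    Type _ :=
  cocycles R X k ⧸ (coboundaries R X k).submoduleOf (cocycles R X k)

namespace SingularCohomology

variable {R : Type*} [CommRing R] {X Y : Type*} [TopologicalSpace X] [TopologicalSpace Y]

/-- The cohomology class of a cocycle. -/
def mk {k : ℤ} (a : cocycles R X k) : SingularCohomology R X k :=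
  Submodule.Quotient.mk a

lemma mk_eq_zero {k : ℤ} {a : cocycles R X k}
    (h : (a : SingularCochain R X) ∈ coboundaries R X k) : mk a = 0 :=
  (Submodule.Quotient.mk_eq_zero _).2 h

/-- The cup product on the level of cocycles. -/
def cupAux (p q : ℤ) :
    cocycles R X p →ₗ[R] cocycles R X q →ₗ[R] SingularCohomology R X (p + q) :=
  LinearMap.mk₂ R
    (fun a b => mk ⟨a.1.mul b.1, mul_mem_cocycles a.2 b.2⟩)
    (fun a a' b => congrArg mk (Subtype.ext (LinearMap.map_add₂ mulₗ a.1 a'.1 b.1)))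
    (fun c a b => congrArg mk (Subtype.ext (LinearMap.map_smul₂ mulₗ c a.1 b.1)))
    (fun a b b' => congrArg mk (Subtype.ext ((mulₗ a.1).map_add b.1 b'.1)))
    (fun c a b => congrArg mk (Subtype.ext ((mulₗ a.1).map_smul c b.1)))

/-- The cup product as a bilinear map. -/
def cupₗ (p q : ℤ) : SingularCohomology R X p →ₗ[R] SingularCohomology R X q →ₗ[R]
    SingularCohomology R X (p + q) :=
  Submodule.liftQ _
    (LinearMap.flip (Submodule.liftQ _ (LinearMap.flip (cupAux p q)) (by
      intro b hb
      refine LinearMap.mem_ker.2 (LinearMap.ext fun a => ?_)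
      exact mk_eq_zero (a := ⟨a.1.mul b.1, mul_mem_cocycles a.2 b.2⟩)
        (mul_mem_coboundaries_right a.2 hb))))
    (by
      intro a ha
      refine LinearMap.mem_ker.2 (LinearMap.ext fun b => ?_)
      obtain ⟨b, rfl⟩ := Submodule.Quotient.mk_surjective _ b
      exact mk_eq_zero (a := ⟨a.1.mul b.1, mul_mem_cocycles a.2 b.2⟩)
        (mul_mem_coboundaries_left ha b.2))

/-- The cup product `H^p(X; R) × H^q(X; R) → H^{p+q}(X; R)`, induced by the cochain
multiplication. -/
def cup {p q : ℤ} (α : SingularCohomology R X p) (β : SingularCohomology R X q) :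
    SingularCohomology R X (p + q) :=
  cupₗ (R := R) (X := X) p q α β

lemma cup_mk {p q : ℤ} (a : cocycles R X p) (b : cocycles R X q) :
    cup (mk a) (mk b) = mk ⟨a.1.mul b.1, mul_mem_cocycles a.2 b.2⟩ := rfl

/-- Cocycles pull back to cocycles. -/
def pullbackCocycles (φ : C(X, Y)) (k : ℤ) : cocycles R Y k →ₗ[R] cocycles R X k :=
  (SingularCochain.pullback φ).restrict fun f hf => ⟨pullback_mem φ hf.1, by
    have h : d f = 0 := hf.2
    change d (SingularCochain.pullback φ f) = 0
    rw [d_pullback, h, map_zero]⟩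

/-- The map `φ^* : H^k(Y; R) → H^k(X; R)` induced by a continuous map `φ : X → Y`, as a linear
map. -/
def pullbackₗ (φ : C(X, Y)) (k : ℤ) : SingularCohomology R Y k →ₗ[R] SingularCohomology R X k :=
  Submodule.mapQ _ _ (pullbackCocycles φ k) (by
    rintro ⟨f, hf⟩ ⟨h, hh, hd⟩
    exact ⟨SingularCochain.pullback φ h, pullback_mem φ hh,
      (d_pullback φ h).trans (congrArg _ hd)⟩)

/-- The class `φ^* α`. -/
def pullback (φ : C(X, Y)) {k : ℤ} (α : SingularCohomology R Y k) : SingularCohomology R X k :=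
  pullbackₗ (R := R) φ k α

lemma pullback_mk (φ : C(X, Y)) {k : ℤ} (a : cocycles R Y k) :
    pullback φ (mk a) = mk (pullbackCocycles φ k a) := rfl

/-- The cohomology cross product `α × β = p₁^* α ∪ p₂^* β`. -/
def cross {p q : ℤ} (α : SingularCohomology R X p) (β : SingularCohomology R Y q) :
    SingularCohomology R (X × Y) (p + q) :=
  cup (pullback ContinuousMap.fst α) (pullback ContinuousMap.snd β)

/-- The Massey product `⟨α, β, γ⟩` is defined if `α ∪ β = 0 = β ∪ γ`. -/
def MasseyDefined {p q r : ℤ} (α : SingularCohomology R X p) (β : SingularCohomology R X q)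
    (γ : SingularCohomology R X r) : Prop :=
  cup α β = 0 ∧ cup β γ = 0

/-- The Massey triple product `⟨α, β, γ⟩ ⊆ H^{p+q+r-1}(X; R)`: the set of all classes of cocycles
`a • l + (-1)^{p+1} m • c`, where `a`, `b`, `c` are cocycles representing `α`, `β`, `γ`, and
`m`, `l` are cochains of degrees `p + q - 1` and `q + r - 1` with `d m = a • b`, `d l = b • c`. -/
def masseyProduct {p q r : ℤ} (α : SingularCohomology R X p) (β : SingularCohomology R X q)
    (γ : SingularCohomology R X r) : Set (SingularCohomology R X (p + q + r - 1)) :=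
  {θ | ∃ (a : cocycles R X p) (b : cocycles R X q) (c : cocycles R X r)
      (m : degree R X (p + q - 1)) (l : degree R X (q + r - 1))
      (z : cocycles R X (p + q + r - 1)),
      mk a = α ∧ mk b = β ∧ mk c = γ ∧
      d m.1 = a.1.mul b.1 ∧ d l.1 = b.1.mul c.1 ∧
      z.1 = a.1.mul l.1 + (p + 1).negOnePow • m.1.mul c.1 ∧ mk z = θ}

end SingularCohomology

/-- A space is of finite type over the field `F` if its cohomology with coefficients in `F` is
finite-dimensional in each degree. (As `H^k(X; F)` is dual to `H_k(X; F)`, this says the same as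
finite-dimensionality of each `H_k(X; F)`; it holds if each `H_k(X; ℤ)` is finitely generated.) -/
def IsOfFiniteType (F : Type*) [Field F] (X : Type*) [TopologicalSpace X] : Prop :=
  ∀ k : ℤ, Module.Finite F (SingularCohomology F X k)

end

/-! Pull all six classes back to the product and write `a₁`, `a₂`, ... for representing cocycles
there. The cross products are then represented by `a₁ a₂`, `b₁ b₂`, `c₁ c₂`. Let `d m₁ = a₁ b₁` and
`d l₂ = b₂ c₂`. If cochains commuted strictly in the graded sense, one could take `m = ± m₁ a₂ b₂`
and `l = ± b₁ c₁ l₂`. The two parts of the Massey cocycle would be `± d(m₁ c₁) a₂ l₂` and `± m₁ c₁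
d(a₂ l₂)`, and together they would form `± d(m₁ c₁ a₂ l₂)`.

Cochains commute only up to homotopy. Cup-one products give `u`, `v`, `w` that commute `a₂` past
`b₁`, `b₂` past `c₁` and `a₂` past `c₁` (`exists_d_eq_mul_sub_mul`). With these as correction terms
the argument becomes an identity in any differential graded ring
(`massey_null_of_homotopy_commute`).

To prove the cup-one formula, a cochain on a simplex is read as a function on words of vertices.
Coboundary and products then obey recursions on the first letter, and induction on the word replaces
the reindexing of multiple sums (`WordCochain.d_cupOne`).

The other alternative of the hypothesis is the same statement with the factors interchanged, after a
sign correction of the representatives. -/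

/-! ### Cochains on words of vertices -/

namespace WordCochain

variable {R V W : Type*} [CommRing R]

/-- The coboundary of a function on words, by recursion on the first letter. -/
def d : (List V → R) → List V → R
  | _, [] => 0
  | f, x :: L => f L - d (fun M => f (x :: M)) L

/-- The product `f • g` of functions on words, written `mul g f` because of the recursion on `f`:
a word is split in two parts that share a letter. -/
def mul (g : List V → R) : (List V → R) → List V → R
  | _, [] => 0
  | f, x :: L => f [x] * g (x :: L) + mul g (fun M => f (x :: M)) L

/-- The product `mul g f` with signs that depend on the position of the shared letter. -/
def signedMul (t : R) (g : List V → R) : (List V → R) → List V → R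
  | _, [] => 0
  | f, x :: L => t * (f [x] * g (x :: L) - signedMul t g (fun M => f (x :: M)) L)

/-- Steenrod's cup-one product `f ∪₁ g`: a subword, from `x` to `y`, is fed to `g`, and the word
in which the interior of that subword is deleted is fed to `f`. The sign is `t` to the number of
letters before `x`. -/
def cupOne (t : R) (g : List V → R) : (List V → R) → List V → R
  | _, [] => 0
  | f, x :: L => mul (fun M => f (x :: M)) (fun M => g (x :: M)) L +
      t * cupOne t g (fun M => f (x :: M)) L

lemma d_comb (a b : R) (f g : List V → R) (L : List V) :
    d (fun M => a * f M + b * g M) L = a * d f L + b * d g L := by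
  induction L generalizing f g with
  | nil => simp [d]
  | cons x L ih => simp only [d, ih]; ring

lemma mul_comb_right (a b : R) (f g g' : List V → R) (L : List V) :
    mul (fun M => a * g M + b * g' M) f L = a * mul g f L + b * mul g' f L := by
  induction L generalizing f with
  | nil => simp [mul]
  | cons x L ih => simp only [mul, ih]; ring

lemma mul_comb_left (a b : R) (f f' g : List V → R) (L : List V) :
    mul g (fun M => a * f M + b * f' M) L = a * mul g f L + b * mul g f' L := by
  induction L generalizing f f' with
  | nil => simp [mul]
  | cons x L ih => simp only [mul, ih]; ring

lemma cupOne_comb (a b t : R) (f f' g : List V → R) (L : List V) :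
    cupOne t g (fun M => a * f M + b * f' M) L = a * cupOne t g f L + b * cupOne t g f' L := by
  induction L generalizing f f' with
  | nil => simp [cupOne]
  | cons x L ih => simp only [cupOne, ih, mul_comb_right]; ring

lemma cupOne_zero (t : R) (g : List V → R) (L : List V) : cupOne t g (fun _ => 0) L = 0 := by
  simpa using cupOne_comb 0 0 t (fun _ => 0) (fun _ => 0) g L

theorem mul_assoc' (f g h : List V → R) (L : List V) :
    mul h (mul g f) L = mul (mul h g) f L := by
  induction L generalizing f with
  | nil => simp [mul]
  | cons x L ih =>
    have h1 := mul_comb_left (f [x]) 1 (fun M => g (x :: M)) (mul g fun M => f (x :: M)) h L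
    simp only [one_mul] at h1
    simp only [mul, h1, ih]
    ring

/-- The Leibniz rule, for functions that may be nonzero on the empty word. -/
theorem d_mul (f g : List V → R) (L : List V) :
    d (mul g f) L = mul g (d f) L - mul (d g) (fun M => (-1) ^ M.length * f M) L -
      f [] * g L + g [] * ((-1) ^ L.length * f L) := by
  -- Deletion may leave the empty word, so `d f [x] = f []`. The two terms with `f []` and `g []`
  -- remove the resulting end contributions of `d f` and `d g`, which `d (mul g f)` lacks.
  induction L generalizing f with
  | nil => simp [d, mul]; ring
  | cons x L ih =>
    have h1 := d_comb (f [x]) 1 (fun M => g (x :: M)) (mul g fun M => f (x :: M)) L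
    have h2 : mul g (fun M => f M - d (fun N => f (x :: N)) M) L =
        mul g f L - mul g (d fun N => f (x :: N)) L := by
      simpa [sub_eq_add_neg] using mul_comb_left 1 (-1) f (d fun M => f (x :: M)) g L
    have h3 : mul (d g) (fun M => (-1) ^ (M.length + 1) * f (x :: M)) L =
        -mul (d g) (fun M => (-1) ^ M.length * f (x :: M)) L := by
      simpa [pow_succ] using
        mul_comb_left (-1) 0 (fun M => (-1) ^ M.length * f (x :: M)) 0 (d g) L
    simp only [one_mul] at h1
    simp only [d, mul, h1, ih, h3, h2, List.length_cons, List.length_nil]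
    ring

/-- The coboundary of `f ∪₁ g` for a cocycle `g`. -/
theorem d_cupOne {t : R} (ht : t * t = 1) {g : List V → R}
    (hg : ∀ L, (-1) ^ L.length * g L = t * g L) (hd : ∀ L, d g L = 0) (f : List V → R)
    (L : List V) :
    d (cupOne t g f) L = t * cupOne t g (d f) L - t * mul f g L + signedMul t g f L := by
  induction L generalizing f with
  | nil => simp [d, mul, cupOne, signedMul]
  | cons x L ih =>
    have h1 := d_comb 1 t (mul (fun M => f (x :: M)) (fun M => g (x :: M)))
      (cupOne t g (fun M => f (x :: M))) L
    have h2 : mul (fun M => f M - d (fun N => f (x :: N)) M) (fun M => g (x :: M)) L =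
        mul f (fun M => g (x :: M)) L -
          mul (d fun M => f (x :: M)) (fun M => g (x :: M)) L := by
      simpa [sub_eq_add_neg] using
        mul_comb_right 1 (-1) (fun M => g (x :: M)) f (d fun M => f (x :: M)) L
    have h3 : cupOne t g (fun M => f M - d (fun N => f (x :: N)) M) L =
        cupOne t g f L - cupOne t g (d fun M => f (x :: M)) L := by
      simpa [sub_eq_add_neg] using cupOne_comb 1 (-1) t f (d fun M => f (x :: M)) g L
    -- Prefixing `x` is a cone contraction: the cocycle condition at `x :: M` exhibits `g` as a
    -- coboundary.
    have h6 : d (fun M => g (x :: M)) = g := by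
      funext M
      have := hd (x :: M)
      simp only [d] at this
      linear_combination -this
    have h7 : (fun M : List V => (-1) ^ M.length * g (x :: M)) =
        fun M => -t * g (x :: M) + 0 * (0 : List V → R) M := by
      funext M
      have := hg (x :: M)
      simp only [List.length_cons, pow_succ] at this
      simp only [Pi.zero_apply]
      linear_combination -this
    -- The empty-word terms of this Leibniz rule are, up to sign, `g [x] * f (x :: L)` and `f [x] *
    -- g (x :: L)`: the leading terms of the two products in the claim.
    have h8 := d_mul (fun M => g (x :: M)) (fun M => f (x :: M)) L
    have h9 := mul_comb_left (-t) 0 (fun M => g (x :: M)) 0 (d fun M => f (x :: M)) L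
    have h10 : -g [x] = t * g [x] := by simpa using hg [x]
    have h11 := congrFun h7 L
    simp only [one_mul] at h1
    rw [h6, h7, h9] at h8
    simp only [Pi.zero_apply] at h11
    simp only [d, mul, cupOne, signedMul, h1, h2, h3, h8, h11, ih]
    linear_combination (-f (x :: L)) * h10 +
      (mul (fun M => f (x :: M)) g L - cupOne t g f L) * ht

/-- For a factor supported on words of length `m` the two products agree up to sign. -/
lemma signedMul_eq (t : R) (g : List V → R) (ht : t * t = 1) {f : List V → R} {m : ℤ}
    (hf : ∀ L : List V, (L.length : ℤ) ≠ m → f L = 0) (L : List V) :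
    signedMul t g f L = (if Even m then -1 else t) * mul g f L := by
  induction L generalizing f m with
  | nil => simp [signedMul, mul]
  | cons x L ih =>
    have h1 : signedMul t g (fun M => f (x :: M)) L =
        (if Even (m - 1) then -1 else t) * mul g (fun M => f (x :: M)) L := by
      refine ih fun M hM => hf _ ?_
      push_cast [List.length_cons]; omega
    simp only [signedMul, mul, h1]
    by_cases h : Even m
    · have h0 : f [x] = 0 := hf _ (by rintro rfl; simp at h)
      have h' : ¬ Even (m - 1) := by simp [h]
      simp only [h, h', if_true, if_false, h0]
      linear_combination (-mul g (fun M => f (x :: M)) L) * ht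
    · have h' : Even (m - 1) := by simpa [Int.even_sub_one] using h
      simp only [h, h', if_true, if_false]
      ring

/-- The two parts share one letter, so their lengths add up to one more than that of the word. In
`cupOne` both ends of the inner subword are shared, whence the 2 in `cupOne_eq_zero`. -/
lemma mul_eq_zero {m k : ℤ} {f g : List V → R}
    (hf : ∀ L : List V, (L.length : ℤ) ≠ m → f L = 0)
    (hg : ∀ L : List V, (L.length : ℤ) ≠ k → g L = 0) {L : List V}
    (hL : (L.length : ℤ) + 1 ≠ m + k) : mul g f L = 0 := by
  induction L generalizing f m with
  | nil => rfl
  | cons x L ih =>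
    have h1 : mul g (fun M => f (x :: M)) L = 0 := by
      refine ih (m := m - 1) (fun M hM => hf _ ?_) ?_ <;> push_cast [List.length_cons] at * <;> omega
    have h2 : f [x] * g (x :: L) = 0 := by
      by_cases h : m = 1
      · rw [hg (x :: L), mul_zero]
        push_cast [List.length_cons] at *; omega
      · rw [hf [x], zero_mul]
        simpa using Ne.symm h
    simp [mul, h1, h2]

lemma cupOne_eq_zero {t : R} {m k : ℤ} {f g : List V → R}
    (hf : ∀ L : List V, (L.length : ℤ) ≠ m → f L = 0)
    (hg : ∀ L : List V, (L.length : ℤ) ≠ k → g L = 0) {L : List V}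
    (hL : (L.length : ℤ) + 2 ≠ m + k) : cupOne t g f L = 0 := by
  induction L generalizing f m with
  | nil => rfl
  | cons x L ih =>
    have h1 : cupOne t g (fun M => f (x :: M)) L = 0 := by
      refine ih (m := m - 1) (fun M hM => hf _ ?_) ?_ <;> push_cast [List.length_cons] at * <;> omega
    have h2 : mul (fun M => f (x :: M)) (fun M => g (x :: M)) L = 0 := by
      refine mul_eq_zero (m := k - 1) (k := m - 1) (fun M hM => hg _ ?_) (fun M hM => hf _ ?_) ?_ <;>
        push_cast [List.length_cons] at * <;> omega
    simp [cupOne, h1, h2]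

lemma mul_map (φ : W → V) (f g : List V → R) (L : List W) :
    mul (fun M => g (M.map φ)) (fun M => f (M.map φ)) L = mul g f (L.map φ) := by
  induction L generalizing f with
  | nil => rfl
  | cons x L ih => simp [mul, ← ih]

lemma cupOne_map (t : R) (φ : W → V) (f g : List V → R) (L : List W) :
    cupOne t (fun M => g (M.map φ)) (fun M => f (M.map φ)) L = cupOne t g f (L.map φ) := by
  induction L generalizing f with
  | nil => rfl
  | cons x L ih => simp [cupOne, ← ih, ← mul_map]

lemma d_eq_sum (f : List V → R) (L : List V) :
    d f L = ∑ k ∈ Finset.range L.length, (-1) ^ k * f (L.eraseIdx k) := by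
  induction L generalizing f with
  | nil => simp [d]
  | cons x L ih =>
    rw [d, ih, List.length_cons, Finset.sum_range_succ']
    simp [pow_succ, Finset.sum_neg_distrib]
    ring

lemma mul_eq_sum (f g : List V → R) (L : List V) :
    mul g f L = ∑ k ∈ Finset.range L.length, f (L.take (k + 1)) * g (L.drop k) := by
  induction L generalizing f with
  | nil => simp [mul]
  | cons x L ih =>
    rw [mul, ih, List.length_cons, Finset.sum_range_succ', add_comm]
    simp

end WordCochain
-- Singular cochains as functions on words, and homotopy commutativity
noncomputable section

namespace SingularCochain

variable {R X : Type*} [CommRing R] [TopologicalSpace X]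

/-- A cochain as a function on words in the vertices of a simplex `σ`. It is zero on the empty
word. -/
def word (f : SingularCochain R X) {n : ℕ} (σ : SingularSimplex X n) : List (Fin (n + 1)) → R
  | [] => 0
  | x :: L => f ⟨L.length, σ.restrict (x :: L).get⟩

lemma word_of_length (f : SingularCochain R X) {n m : ℕ} (σ : SingularSimplex X n)
    (φ : Fin (m + 1) → Fin (n + 1)) {L : List (Fin (n + 1))} (hL : L.length = m + 1)
    (hφ : ∀ j : Fin (m + 1), L[(j : ℕ)]'(by omega) = φ j) :
    f.word σ L = f ⟨m, σ.restrict φ⟩ := by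
  cases L with
  | nil => simp at hL
  | cons x L =>
    obtain rfl : L.length = m := by simpa using hL
    obtain rfl : (x :: L).get = φ := funext hφ
    rfl

lemma word_finRange (f : SingularCochain R X) {n : ℕ} (σ : SingularSimplex X n) :
    f.word σ (List.finRange (n + 1)) = f ⟨n, σ⟩ := by
  rw [word_of_length f σ id (by simp) (by simp), restrict_id]

lemma word_restrict (f : SingularCochain R X) {m n : ℕ} (σ : SingularSimplex X n)
    (φ : Fin (m + 1) → Fin (n + 1)) :
    f.word (σ.restrict φ) = fun L => f.word σ (L.map φ) := by
  funext L
  cases L with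
  | nil => rfl
  | cons x L =>
    rw [word_of_length f σ (φ ∘ (x :: L).get) (by simp)
      (fun j => by rw [List.getElem_map]; rfl), ← restrict_restrict]
    rfl

lemma word_eq_zero {p : ℤ} {f : SingularCochain R X} (hf : f ∈ degree R X p) {n : ℕ}
    (σ : SingularSimplex X n) (L : List (Fin (n + 1))) (hL : (L.length : ℤ) ≠ p + 1) :
    f.word σ L = 0 := by
  cases L with
  | nil => rfl
  | cons x L => exact hf _ _ fun h => hL (by simp [h])

lemma word_d (f : SingularCochain R X) {n : ℕ} (σ : SingularSimplex X n) :
    (d f).word σ = WordCochain.d (f.word σ) := by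
  funext L
  rcases L with _ | ⟨x, _ | ⟨y, L⟩⟩
  · rfl
  -- The value 0 on the empty word matches the vanishing of `d f` on 0-simplices.
  · simp [WordCochain.d, word, d]
  · rw [WordCochain.d_eq_sum, Finset.sum_range]
    change ∑ i : Fin (L.length + 2), _ = _
    refine Finset.sum_congr rfl fun k _ => ?_
    rw [restrict_restrict, ← word_of_length f σ (L := (x :: y :: L).eraseIdx k)]
    · rw [List.length_eraseIdx_of_lt k.2]; rfl
    · intro j
      simp only [List.getElem_eraseIdx, Function.comp, Fin.succAbove, Fin.lt_def, Fin.val_castSucc]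
      split_ifs <;> rfl

lemma word_mul (f g : SingularCochain R X) {n : ℕ} (σ : SingularSimplex X n) :
    (f.mul g).word σ = WordCochain.mul (g.word σ) (f.word σ) := by
  funext L
  rcases L with _ | ⟨x, L⟩
  · rfl
  · rw [WordCochain.mul_eq_sum, Finset.sum_range]
    change ∑ i : Fin (L.length + 1), _ = _
    refine Finset.sum_congr rfl fun k _ => ?_
    have hk : (k : ℕ) < L.length + 1 := k.2
    rw [restrict_restrict, restrict_restrict,
      ← word_of_length f σ (L := (x :: L).take (k + 1)),
      ← word_of_length g σ (L := (x :: L).drop k)]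
    · simp; omega
    · intro j
      simp [List.getElem_drop]
    · simp; omega
    · intro j
      rw [List.getElem_take]
      rfl

theorem mul_assoc' (f g h : SingularCochain R X) : (f.mul g).mul h = f.mul (g.mul h) := by
  funext ⟨n, σ⟩
  simp only [← word_finRange, word_mul, WordCochain.mul_assoc']

/-- Steenrod's cup-one product of cochains, with sign `t` as in `WordCochain.cupOne`. -/
def cupOne (t : R) (f g : SingularCochain R X) : SingularCochain R X := fun s =>
  WordCochain.cupOne t (g.word s.2) (f.word s.2) (List.finRange (s.1 + 1))

lemma cupOne_mem {p q : ℤ} {f g : SingularCochain R X} (t : R) (hf : f ∈ degree R X p)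
    (hg : g ∈ degree R X q) : cupOne t f g ∈ degree R X (p + q - 1) := fun n σ h =>
  WordCochain.cupOne_eq_zero (word_eq_zero hf σ) (word_eq_zero hg σ) (by simp; omega)

/-- By naturality under relabelling of letters, the value of `cupOne` on a face of `σ` is the word
cup-one product, taken in `σ`, of the vertex list with one entry erased. -/
lemma d_cupOne_apply (t : R) (f g : SingularCochain R X) {n : ℕ} (σ : SingularSimplex X n) :
    d (cupOne t f g) ⟨n, σ⟩ =
      WordCochain.d (WordCochain.cupOne t (g.word σ) (f.word σ)) (List.finRange (n + 1)) := by
  cases n with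
  | zero => simp [d, WordCochain.d, WordCochain.cupOne, List.finRange_succ]
  | succ n =>
    rw [WordCochain.d_eq_sum, Finset.sum_range]
    change ∑ i : Fin (n + 2), _ = _
    refine Finset.sum_equiv (finCongr (by simp)) (by simp) fun k _ => ?_
    simp only [cupOne, word_restrict, WordCochain.cupOne_map]
    congr 2
    refine List.ext_getElem (by
      simp [List.length_eraseIdx, Nat.lt_succ_iff.mp k.2]) fun j h1 h2 => ?_
    simp only [List.getElem_eraseIdx, List.getElem_map, List.getElem_finRange, Fin.succAbove,
      Fin.lt_def, finCongr_apply, Fin.val_cast]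
    split_ifs <;> simp_all

/-- Graded commutativity of the multiplication of cocycles, up to the coboundary of a cup-one
product. -/
theorem exists_d_eq_mul_sub_mul {p q : ℤ} {f g : SingularCochain R X} (hf : f ∈ cocycles R X p)
    (hg : g ∈ cocycles R X q) : ∃ u ∈ degree R X (p + q - 1),
      d u = f.mul g - (p * q).negOnePow • g.mul f := by
  obtain ⟨hf, hdf⟩ := hf
  obtain ⟨hg, hdg⟩ := hg
  replace hdf : d f = 0 := hdf
  replace hdg : d g = 0 := hdg
  have hz : ∀ {n : ℕ} (σ : SingularSimplex X n), (0 : SingularCochain R X).word σ = fun _ => 0 :=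
    fun σ => by funext L; cases L <;> rfl
  -- `t` is the parity sign of the words, of length `q + 1`, that support `g`. `c` is the sign from
  -- `signedMul_eq` for words of length `p + 1`. Since `c * c = 1`, scaling by `c` gives `f.mul g`
  -- the coefficient 1.
  obtain ⟨t, ht⟩ : ∃ t : R, t = if Even q then -1 else 1 := ⟨_, rfl⟩
  obtain ⟨c, hc⟩ : ∃ c : R, c = if Even (p + 1) then -1 else t := ⟨_, rfl⟩
  have htt : t * t = 1 := by rw [ht]; split_ifs <;> simp
  have hcc : c * c = 1 := by rw [hc]; split_ifs <;> simp [htt]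
  have hct : c * t = ((p * q).negOnePow : ℤ) := by
    rw [hc, ht]
    rcases Int.even_or_odd p with hp | hp <;> rcases Int.even_or_odd q with hq | hq
    · simp [Int.negOnePow_even _ (hp.mul_right q), Int.not_even_iff_odd.2 hp.add_one, hq]
    · simp [Int.negOnePow_even _ (hp.mul_right q), Int.not_even_iff_odd.2 hp.add_one,
        Int.not_even_iff_odd.2 hq]
    · simp [Int.negOnePow_even _ (hq.mul_left p), hp.add_one, hq]
    · simp [Int.negOnePow_odd _ (hp.mul hq), hp.add_one, Int.not_even_iff_odd.2 hq]
  refine ⟨c • cupOne t f g, Submodule.smul_mem _ _ (cupOne_mem t hf hg), ?_⟩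
  funext ⟨n, σ⟩
  have h1 := WordCochain.d_cupOne htt (g := g.word σ) (fun L => by
    by_cases hL : (L.length : ℤ) = q + 1
    · rw [ht]
      congr 1
      rcases Int.even_or_odd q with hq | hq
      · have : Odd L.length := by rw [← Int.odd_coe_nat, hL]; exact hq.add_one
        rw [if_pos hq, this.neg_one_pow]
      · have : Even L.length := by rw [← Int.even_coe_nat, hL]; exact hq.add_one
        rw [if_neg (Int.not_even_iff_odd.2 hq), this.neg_one_pow]
    · rw [word_eq_zero hg σ L hL, mul_zero, mul_zero]) (fun L => by
      rw [← word_d, hdg, hz]) (f.word σ) (List.finRange (n + 1))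
  rw [← d_cupOne_apply, ← word_d, hdf, hz, WordCochain.cupOne_zero, ← word_mul, word_finRange,
    WordCochain.signedMul_eq t _ htt (word_eq_zero hf σ), ← word_mul, word_finRange, ← hc] at h1
  rw [map_smul, Pi.smul_apply, h1, Pi.sub_apply, Pi.smul_apply, Units.smul_def, zsmul_eq_mul, ← hct]
  simp only [smul_eq_mul]
  linear_combination (f.mul g ⟨n, σ⟩) * hcc

/-- The component of degree `k` of a cochain. -/
def component (k : ℤ) (f : SingularCochain R X) : SingularCochain R X := fun s =>
  if (s.1 : ℤ) = k then f s else 0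

lemma component_mem (k : ℤ) (f : SingularCochain R X) : component k f ∈ degree R X k :=
  fun _ _ h => if_neg h

/-- As `d` raises degree by one, only the component of `w` in degree `k - 1` contributes. Hence no
degree has to be tracked for the primitive of the Massey cocycle. -/
lemma mem_coboundaries_of_d_eq {k : ℤ} {z w : SingularCochain R X} (hz : z ∈ degree R X k)
    (h : d w = z) : z ∈ coboundaries R X k := by
  refine ⟨component (k - 1) w, component_mem _ _, ?_⟩
  funext ⟨n, σ⟩
  by_cases hn : (n : ℤ) = k
  · subst h
    cases n with
    | zero => rfl
    | succ n =>
      have : (n : ℤ) = k - 1 := by push_cast at hn; omega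
      simp [d, component, this]
  · rw [hz n σ hn, d_mem (component_mem (k - 1) w) (by ring) n σ hn]

end SingularCochain
end
-- The Massey product in a differential graded ring
noncomputable section

open SingularCochain

/-- Left multiplication by `x` satisfies the Leibniz rule with sign `s`. -/
def IsLeibniz {A : Type*} [NonUnitalRing A] (d : A →+ A) (s : ℤ) (x : A) : Prop :=
  s * s = 1 ∧ ∀ y, d (x * y) = d x * y + s • (x * d y)

/-- In a differential graded ring, let `a₁ b₁ = d m₁` and `b₂ c₂ = d l₂`, and suppose that `a₂`
commutes with `b₁` and `c₁`, and `b₂` with `c₁`, up to sign and homotopy. Then the Massey product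
of `a₁ a₂`, `b₁ b₂`, `c₁ c₂` contains zero. -/
theorem massey_null_of_homotopy_commute {A : Type*} [NonUnitalRing A] (d : A →+ A)
    {a₁ a₂ b₁ b₂ c₁ c₂ m₁ l₂ u v w : A} {A₁ A₂ B₁ B₂ C₁ V x₁ x₂ x₃ : ℤ}
    (ha₁ : IsLeibniz d A₁ a₁) (ha₂ : IsLeibniz d A₂ a₂) (hb₁ : IsLeibniz d B₁ b₁)
    (hb₂ : IsLeibniz d B₂ b₂) (hc₁ : IsLeibniz d C₁ c₁)
    (hm₁ : IsLeibniz d (-(A₁ * B₁)) m₁)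
    (hu : IsLeibniz d (-(A₂ * B₁)) u) (hv : IsLeibniz d V v) (hw : IsLeibniz d (-(A₂ * C₁)) w)
    (da₁ : d a₁ = 0) (da₂ : d a₂ = 0) (db₁ : d b₁ = 0) (db₂ : d b₂ = 0) (dc₁ : d c₁ = 0)
    (dc₂ : d c₂ = 0) (dm₁ : d m₁ = a₁ * b₁) (dl₂ : d l₂ = b₂ * c₂)
    (du : d u = a₂ * b₁ - x₁ • (b₁ * a₂)) (dv : d v = b₂ * c₁ - x₂ • (c₁ * b₂))
    (dw : d w = a₂ * c₁ - x₃ • (c₁ * a₂)) :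
    d (A₁ • (a₁ * (u * b₂)) + x₁ • (m₁ * (a₂ * b₂))) = (a₁ * a₂) * (b₁ * b₂) ∧
    d (B₁ • (b₁ * (v * c₂)) + (x₂ * B₁ * C₁) • (b₁ * (c₁ * l₂))) = (b₁ * b₂) * (c₁ * c₂) ∧
    ∃ z, d z = (a₁ * a₂) * (B₁ • (b₁ * (v * c₂)) + (x₂ * B₁ * C₁) • (b₁ * (c₁ * l₂))) +
      (-(A₁ * A₂)) • ((A₁ • (a₁ * (u * b₂)) + x₁ • (m₁ * (a₂ * b₂))) * (c₁ * c₂)) := by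
  -- The first term is the primitive of the strictly commutative case. The terms with a single `u`,
  -- `v` or `w` account for the transpositions used there, and `a₁ u v c₂` for the interaction of
  -- two of them.
  refine ⟨?_, ?_, (x₁ * x₂ * x₃ * B₁ * C₁) • (m₁ * (c₁ * (a₂ * l₂))) +
    (x₂ * A₁ * B₁ * C₁) • (a₁ * (u * (c₁ * l₂)) + (x₁ * B₁) • (a₁ * (b₁ * (w * l₂)))) +
    (x₁ * A₂ * B₁) • (A₂ • (m₁ * (a₂ * (v * c₂))) + x₂ • (m₁ * (w * (b₂ * c₂)))) +
    (A₁ * B₁) • (a₁ * (u * (v * c₂))), ?_⟩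
  -- After expansion both sides are integer combinations of right-associated monomials. Comparing
  -- coefficients needs only that the signs square to 1.
  all_goals
    simp only [map_add, map_zsmul, ha₁.2, ha₂.2, hb₁.2, hb₂.2, hc₁.2, hm₁.2, hu.2, hv.2, hw.2,
      da₁, da₂, db₁, db₂, dc₁, dc₂, dm₁, dl₂, du, dv, dw, mul_add, add_mul, mul_sub, sub_mul,
      smul_mul_assoc, mul_smul_comm, mul_assoc, zero_mul, mul_zero, smul_zero, add_zero, zero_add]
    replace ha₁ := ha₁.1
    replace ha₂ := ha₂.1
    replace hb₁ := hb₁.1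
    replace hc₁ := hc₁.1
    match_scalars <;> grind

/-! ### Massey products of singular cocycles -/

namespace SingularCohomology

variable {R : Type*} [CommRing R] {X Y : Type*} [TopologicalSpace X] [TopologicalSpace Y]

/-- Singular cochains as a ring for the cochain multiplication. -/
def CochainRing (R X : Type*) [CommRing R] [TopologicalSpace X] : Type _ := SingularCochain R X

/-- The type synonym avoids a clash with the pointwise product on functions. -/
instance : NonUnitalRing (CochainRing R X) :=
  { (inferInstance : AddCommGroup (SingularCochain R X)) with
    mul := SingularCochain.mul
    left_distrib := fun f g h => (mulₗ (R := R) (X := X) f).map_add g h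
    right_distrib := fun f g h => LinearMap.map_add₂ (mulₗ (R := R) (X := X)) f g h
    zero_mul := fun f => LinearMap.map_zero₂ (mulₗ (R := R) (X := X)) f
    mul_zero := fun f => (mulₗ (R := R) (X := X) f).map_zero
    mul_assoc := SingularCochain.mul_assoc' }

/-- The coboundary as an additive endomorphism of the ring of cochains. -/
def coboundaryHom (R X : Type*) [CommRing R] [TopologicalSpace X] :
    CochainRing R X →+ CochainRing R X :=
  (d : SingularCochain R X →ₗ[R] SingularCochain R X).toAddMonoidHom

lemma negOnePow_mul_self (p : ℤ) : (p.negOnePow : ℤ) * p.negOnePow = 1 := by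
  rw [← Units.val_mul, Int.units_mul_self, Units.val_one]

lemma isLeibniz_of_mem {p : ℤ} {f : SingularCochain R X} (hf : f ∈ degree R X p) :
    IsLeibniz (coboundaryHom R X) p.negOnePow f :=
  ⟨negOnePow_mul_self p, fun g => d_mul hf g⟩

/-- Expresses the sign of a primitive or homotopy through the signs of its two factors, so that the
sign conditions become polynomial identities. -/
lemma isLeibniz_of_mem_pred {p q k : ℤ} {f : SingularCochain R X} (hf : f ∈ degree R X k)
    (hk : p + q - 1 = k) :
    IsLeibniz (coboundaryHom R X) (-((p.negOnePow : ℤ) * q.negOnePow)) f := by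
  have := isLeibniz_of_mem hf
  rwa [← hk, Int.negOnePow_sub, Int.negOnePow_one, Int.negOnePow_add, mul_neg, mul_one,
    Units.val_neg, Units.val_mul] at this

lemma zsmul_mem_degree {k : ℤ} {f : SingularCochain R X} (s : ℤ) (hf : f ∈ degree R X k) :
    s • f ∈ degree R X k := (degree R X k).toAddSubgroup.zsmul_mem hf s

/-- If `α₁ β₁ = 0` and `β₂ γ₂ = 0`, then the Massey product of `α₁ α₂`, `β₁ β₂`, `γ₁ γ₂` contains
zero, on the level of cochains. -/
theorem exists_massey_null {p₁ p₂ q₁ q₂ r₁ r₂ : ℤ} {a₁ a₂ b₁ b₂ c₁ c₂ m₁ l₂ : SingularCochain R X}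
    (ha₁ : a₁ ∈ cocycles R X p₁) (ha₂ : a₂ ∈ cocycles R X p₂) (hb₁ : b₁ ∈ cocycles R X q₁)
    (hb₂ : b₂ ∈ cocycles R X q₂) (hc₁ : c₁ ∈ cocycles R X r₁) (hc₂ : c₂ ∈ cocycles R X r₂)
    (hm₁ : m₁ ∈ degree R X (p₁ + q₁ - 1)) (dm₁ : d m₁ = a₁.mul b₁)
    (hl₂ : l₂ ∈ degree R X (q₂ + r₂ - 1)) (dl₂ : d l₂ = b₂.mul c₂) :
    ∃ m ∈ degree R X (p₁ + p₂ + (q₁ + q₂) - 1), ∃ l ∈ degree R X (q₁ + q₂ + (r₁ + r₂) - 1),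
      d m = (a₁.mul a₂).mul (b₁.mul b₂) ∧ d l = (b₁.mul b₂).mul (c₁.mul c₂) ∧
      ∃ z, d z = (a₁.mul a₂).mul l + (p₁ + p₂ + 1).negOnePow • m.mul (c₁.mul c₂) := by
  obtain ⟨u, hu, du⟩ := exists_d_eq_mul_sub_mul ha₂ hb₁
  obtain ⟨v, hv, dv⟩ := exists_d_eq_mul_sub_mul hb₂ hc₁
  obtain ⟨w, hw, dw⟩ := exists_d_eq_mul_sub_mul ha₂ hc₁
  obtain ⟨h1, h2, z, h3⟩ := massey_null_of_homotopy_commute (coboundaryHom R X)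
    (isLeibniz_of_mem ha₁.1) (isLeibniz_of_mem ha₂.1) (isLeibniz_of_mem hb₁.1)
    (isLeibniz_of_mem hb₂.1) (isLeibniz_of_mem hc₁.1) (isLeibniz_of_mem_pred hm₁ rfl)
    (isLeibniz_of_mem_pred hu rfl) (isLeibniz_of_mem hv) (isLeibniz_of_mem_pred hw rfl)
    ha₁.2 ha₂.2 hb₁.2 hb₂.2 hc₁.2 hc₂.2 dm₁ dl₂ du dv dw
  refine ⟨_, ?_, _, ?_, h1, h2, z, h3.trans ?_⟩
  · refine add_mem (zsmul_mem_degree _ ?_) (zsmul_mem_degree _ ?_)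
    · exact mul_mem ha₁.1 (mul_mem hu hb₂.1 rfl) (by ring)
    · exact mul_mem hm₁ (mul_mem ha₂.1 hb₂.1 rfl) (by ring)
  · refine add_mem (zsmul_mem_degree _ ?_) (zsmul_mem_degree _ ?_)
    · exact mul_mem hb₁.1 (mul_mem hv hc₂.1 rfl) (by ring)
    · exact mul_mem hb₁.1 (mul_mem hc₁.1 hl₂ rfl) (by ring)
  · rw [Int.negOnePow_add (p₁ + p₂), Int.negOnePow_one, Int.negOnePow_add, mul_neg, mul_one,
      Units.smul_def, Units.val_neg, Units.val_mul]
    rfl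

lemma exists_of_mk_eq_zero {k : ℤ} {a : cocycles R X k} (h : mk a = 0) :
    ∃ m ∈ degree R X (k - 1), d m = (a : SingularCochain R X) :=
  (Submodule.Quotient.mk_eq_zero _).1 h

/-- To show that a Massey product contains zero it suffices to find suitable cochains. -/
lemma zero_mem_masseyProduct {p q r : ℤ} (a : cocycles R X p) (b : cocycles R X q)
    (c : cocycles R X r) {m l z : SingularCochain R X}
    (hm : m ∈ degree R X (p + q - 1)) (hl : l ∈ degree R X (q + r - 1))
    (dm : d m = a.1.mul b.1) (dl : d l = b.1.mul c.1)
    (dz : d z = a.1.mul l + (p + 1).negOnePow • m.mul c.1) :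
    0 ∈ masseyProduct (mk a) (mk b) (mk c) := by
  have hdeg : a.1.mul l + (p + 1).negOnePow • m.mul c.1 ∈ degree R X (p + q + r - 1) :=
    add_mem (mul_mem a.2.1 hl (by ring))
      (zsmul_mem_degree _ (mul_mem hm c.2.1 (by ring)))
  have hd := mem_coboundaries_of_d_eq hdeg dz
  refine ⟨a, b, c, ⟨m, hm⟩, ⟨l, hl⟩, ⟨_, hdeg, ?_⟩, rfl, rfl, rfl, dm, dl, rfl, mk_eq_zero hd⟩
  have ha : d a.1 = 0 := a.2.2
  have hc : d c.1 = 0 := c.2.2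
  have h1 : (0 : SingularCochain R X).mul l = 0 := LinearMap.map_zero₂ mulₗ l
  have h2 : m.mul (0 : SingularCochain R X) = 0 := (mulₗ m).map_zero
  -- The two contributions are `(-1)^p a(bc)` and `(-1)^(p+1) (ab)c`; they cancel by strict
  -- associativity.
  change d (a.1.mul l + (p + 1).negOnePow • m.mul c.1) = 0
  rw [map_add, Units.smul_def, map_zsmul, d_mul a.2.1, d_mul hm, dm, dl, ha, hc,
    h1, h2, smul_zero, add_zero, zero_add, SingularCochain.mul_assoc', Int.negOnePow_succ,
    Units.smul_def, Units.val_neg, neg_smul, add_neg_cancel]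

lemma zsmul_mul_zsmul (s t : ℤ) (f g : SingularCochain R X) :
    (s • f).mul (t • g) = (s * t) • f.mul g :=
  smul_mul_smul_comm (α := ℤ) (β := CochainRing R X) s f t g

/-- Up to sign, the cross product is represented by the product in the other order. -/
lemma exists_mk_eq_cross {p q : ℤ} (a : cocycles R X p) (b : cocycles R Y q) :
    ∃ e : cocycles R (X × Y) (p + q), mk e = cross (mk a) (mk b) ∧
      e.1 = ((p * q).negOnePow : ℤ) •
        (pullbackCocycles ContinuousMap.snd q b).1.mul
          (pullbackCocycles ContinuousMap.fst p a).1 := by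
  obtain ⟨f, hf⟩ : ∃ f, f = pullbackCocycles (ContinuousMap.fst : C(X × Y, X)) p a := ⟨_, rfl⟩
  obtain ⟨g, hg⟩ : ∃ g, g = pullbackCocycles (ContinuousMap.snd : C(X × Y, Y)) q b := ⟨_, rfl⟩
  obtain ⟨u, hu, du⟩ := exists_d_eq_mul_sub_mul f.2 g.2
  have he : ((p * q).negOnePow : ℤ) • g.1.mul f.1 ∈ cocycles R (X × Y) (p + q) :=
    zsmul_mem (add_comm q p ▸ mul_mem_cocycles g.2 f.2) _
  refine ⟨⟨_, he⟩, ?_, by subst hf hg; rfl⟩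
  rw [cross, pullback_mk, pullback_mk, cup_mk, ← hf, ← hg]
  refine ((Submodule.Quotient.eq _).2 ?_).symm
  exact ⟨u, hu, du⟩

lemma exists_d_eq_pullback_mul (φ : C(X, Y)) {p q : ℤ} {a : cocycles R Y p} {b : cocycles R Y q}
    (h : cup (mk a) (mk b) = 0) :
    ∃ m ∈ degree R X (p + q - 1),
      d m = (pullbackCocycles φ p a).1.mul (pullbackCocycles φ q b).1 := by
  obtain ⟨m, hm, dm⟩ := exists_of_mk_eq_zero (a := ⟨a.1.mul b.1, mul_mem_cocycles a.2 b.2⟩) h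
  exact ⟨SingularCochain.pullback φ m, pullback_mem φ hm,
    (d_pullback φ m).trans (congrArg (SingularCochain.pullback φ) dm)⟩

end SingularCohomology

end

/-! ### The theorem for a product of two spaces -/

open SingularCochain SingularCohomology

theorem proposition3p3 {F : Type*} [Field F] {X₁ X₂ : Type*} [TopologicalSpace X₁]
    [TopologicalSpace X₂] (hX₁ : IsOfFiniteType F X₁) (hX₂ : IsOfFiniteType F X₂)
    {p₁ p₂ q₁ q₂ r₁ r₂ : ℤ}
    (α₁ : SingularCohomology F X₁ p₁) (α₂ : SingularCohomology F X₂ p₂)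
    (β₁ : SingularCohomology F X₁ q₁) (β₂ : SingularCohomology F X₂ q₂)
    (γ₁ : SingularCohomology F X₁ r₁) (γ₂ : SingularCohomology F X₂ r₂)
    (hdef : SingularCohomology.MasseyDefined (SingularCohomology.cross α₁ α₂)
      (SingularCohomology.cross β₁ β₂) (SingularCohomology.cross γ₁ γ₂))
    (h : (SingularCohomology.cup α₁ β₁ = 0 ∧ SingularCohomology.cup β₂ γ₂ = 0) ∨
      (SingularCohomology.cup α₂ β₂ = 0 ∧ SingularCohomology.cup β₁ γ₁ = 0)) :
    0 ∈ SingularCohomology.masseyProduct (SingularCohomology.cross α₁ α₂)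
      (SingularCohomology.cross β₁ β₂) (SingularCohomology.cross γ₁ γ₂) := by
  obtain ⟨a₁, rfl⟩ := Submodule.Quotient.mk_surjective _ α₁
  obtain ⟨a₂, rfl⟩ := Submodule.Quotient.mk_surjective _ α₂
  obtain ⟨b₁, rfl⟩ := Submodule.Quotient.mk_surjective _ β₁
  obtain ⟨b₂, rfl⟩ := Submodule.Quotient.mk_surjective _ β₂
  obtain ⟨c₁, rfl⟩ := Submodule.Quotient.mk_surjective _ γ₁
  obtain ⟨c₂, rfl⟩ := Submodule.Quotient.mk_surjective _ γ₂
  rcases h with ⟨h₁, h₂⟩ | ⟨h₂, h₁⟩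
  · obtain ⟨m₁, hm₁, dm₁⟩ := exists_d_eq_pullback_mul (ContinuousMap.fst : C(X₁ × X₂, X₁)) h₁
    obtain ⟨l₂, hl₂, dl₂⟩ := exists_d_eq_pullback_mul (ContinuousMap.snd : C(X₁ × X₂, X₂)) h₂
    obtain ⟨m, hm, l, hl, dm, dl, z, dz⟩ := exists_massey_null
      (pullbackCocycles ContinuousMap.fst p₁ a₁).2 (pullbackCocycles ContinuousMap.snd p₂ a₂).2
      (pullbackCocycles ContinuousMap.fst q₁ b₁).2 (pullbackCocycles ContinuousMap.snd q₂ b₂).2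
      (pullbackCocycles ContinuousMap.fst r₁ c₁).2 (pullbackCocycles ContinuousMap.snd r₂ c₂).2
      hm₁ dm₁ hl₂ dl₂
    -- By definition the cross products are the classes of these products of pulled-back cocycles.
    exact zero_mem_masseyProduct ⟨_, mul_mem_cocycles (Subtype.prop _) (Subtype.prop _)⟩
      ⟨_, mul_mem_cocycles (Subtype.prop _) (Subtype.prop _)⟩
      ⟨_, mul_mem_cocycles (Subtype.prop _) (Subtype.prop _)⟩ hm hl dm dl dz
  -- Now the second space plays the role of the first, so the cochain result concerns the products
  -- in the opposite order.
  · obtain ⟨m₂, hm₂, dm₂⟩ := exists_d_eq_pullback_mul (ContinuousMap.snd : C(X₁ × X₂, X₂)) h₂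
    obtain ⟨l₁, hl₁, dl₁⟩ := exists_d_eq_pullback_mul (ContinuousMap.fst : C(X₁ × X₂, X₁)) h₁
    obtain ⟨m, hm, l, hl, dm, dl, z, dz⟩ := exists_massey_null
      (pullbackCocycles ContinuousMap.snd p₂ a₂).2 (pullbackCocycles ContinuousMap.fst p₁ a₁).2
      (pullbackCocycles ContinuousMap.snd q₂ b₂).2 (pullbackCocycles ContinuousMap.fst q₁ b₁).2
      (pullbackCocycles ContinuousMap.snd r₂ c₂).2 (pullbackCocycles ContinuousMap.fst r₁ c₁).2
      hm₂ dm₂ hl₁ dl₁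
    obtain ⟨a, ha, ea⟩ := exists_mk_eq_cross a₁ a₂
    obtain ⟨b, hb, eb⟩ := exists_mk_eq_cross b₁ b₂
    obtain ⟨c, hc, ec⟩ := exists_mk_eq_cross c₁ c₂
    obtain ⟨s, hs⟩ : ∃ s : ℤ, s = (p₁ * p₂).negOnePow := ⟨_, rfl⟩
    obtain ⟨t, ht⟩ : ∃ t : ℤ, t = (q₁ * q₂).negOnePow := ⟨_, rfl⟩
    obtain ⟨v, hv⟩ : ∃ v : ℤ, v = (r₁ * r₂).negOnePow := ⟨_, rfl⟩
    rw [← hs] at ea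
    rw [← ht] at eb
    rw [← hv] at ec
    rw [show p₂ + p₁ + (q₂ + q₁) - 1 = p₁ + p₂ + (q₁ + q₂) - 1 by ring] at hm
    rw [show q₂ + q₁ + (r₂ + r₁) - 1 = q₁ + q₂ + (r₁ + r₂) - 1 by ring] at hl
    rw [add_comm p₂ p₁] at dz
    -- The representatives of the three cross products carry signs `s`, `t`, `v`. By multilinearity
    -- `m`, `l` and `z` are scaled by the signs of the factors that they involve.
    refine ha ▸ hb ▸ hc ▸ zero_mem_masseyProduct a b c (m := (s * t) • m) (l := (t * v) • l)
      (z := (s * t * v) • z) (zsmul_mem_degree _ hm) (zsmul_mem_degree _ hl) ?_ ?_ ?_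
    · rw [map_zsmul, dm, ea, eb, zsmul_mul_zsmul]
    · rw [map_zsmul, dl, eb, ec, zsmul_mul_zsmul]
    · rw [map_zsmul, dz, ea, ec, zsmul_mul_zsmul, zsmul_mul_zsmul]
      simp only [Units.smul_def, smul_add, smul_smul]
      congr 2 <;> ring
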